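/- Let $k$ be an algebraically closed field of characteristic $0$. A variety over $k$ is a separated $k$-scheme of finite type (not necessarily reduced). Let $K_0(\mathrm{Var}_k)$ be the Grothendieck ring of varieties: the free abelian group on isomorphism classes $[X]$ of varieties over $k$, modulo the relations $[X]=[Y]+[X\setminus Y]$ for $Y\hookrightarrow X$ a closed embedding, with $[X]\cdot[Y]=[X\times_k Y]$; put $\mathbb{L}=[\mathbb{A}^1_k]$. For $i\in\mathbb{Z}$ let $F^i\subset K_0(\mathrm{Var}_k)[\mathbb{L}^{-1}]$ be the additive subgroup generated by the elements $[S]/\mathbb{L}^r$ with $S$ of pure dimension $\le i+r$. Assume that the cut-and-paste conjecture holds for $k$: whenever $X,Y$ are varieties over $k$ with $[X]=[Y]$ in $K_0(\mathrm{Var}_k)$, there are finitely many pairwise disjoint locally closed subvarieties $X_1,\dots,X_n$ of $X$ and pairwise disjoint locally closed subvarieties $Y_1,\dots,Y_n$ of $Y$ such that $X=\bigcup_i X_i$ and $Y=\bigcup_i Y_i$ as sets, and $X_i\simeq Y_i$ over $k$ for all $i$. Let $X$ and $Y$ be irreducible varieties over $k$ such that $$\frac{[X]}{\mathbb{L}^{\dim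 X}}=\frac{[Y]}{\mathbb{L}^{\dim Y}}\quad\text{in } F^0/F^{-1}.$$ Then the reduced varieties $X_{\mathrm{red}}$ and $Y_{\mathrm{red}}$ are stably birational, i.e. $X_{\mathrm{red}}\times\mathbb{A}^m$ is birational to $Y_{\mathrm{red}}\times\mathbb{A}^n$ over $k$ for some $m,n\ge 0$. In particular, if $X$ and $Y$ are reduced, then $X$ and $Y$ are stably birational. -/

import Mathlib

universe u

open CategoryTheory AlgebraicGeometry

noncomputable section

namespace MotivicK0

section Varieties

variable (k : Type u) [Field k]

/-- A `k`-scheme is a variety if it is separated and of finite type over `k`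
(it need not be reduced, irreducible or nonempty). -/
def isVariety : ObjectProperty (Over (Spec (CommRingCat.of k))) := fun X =>
  IsSeparated X.hom ∧ LocallyOfFiniteType X.hom ∧ QuasiCompact X.hom

/-- The category `Var_k` of varieties over `k` and `k`-morphisms. -/
abbrev Var : Type (u + 1) := (isVariety k).FullSubcategory

attribute [local instance] Over.cartesianMonoidalCategory Over.braidedCategory

/-- Varieties contain `Spec k` and are closed under `X × Y = X ×_k Y`. -/
instance isVariety_isMonoidal : (isVariety k).IsMonoidal where
  prop_unit := by
    exact ⟨inferInstanceAs (IsSeparated (𝟙 (Spec (CommRingCat.of k)))),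
      inferInstanceAs (LocallyOfFiniteType (𝟙 (Spec (CommRingCat.of k)))),
      inferInstanceAs (QuasiCompact (𝟙 (Spec (CommRingCat.of k))))⟩
  prop_tensor := by
    rintro X Y ⟨_, _, _⟩ ⟨_, _, _⟩
    refine ⟨?_, ?_, ?_⟩ <;> rw [Over.tensorObj_hom] <;> infer_instance

/-- Isomorphism classes of varieties; a commutative monoid under the product over `k`, with unit
the class of `Spec k`. -/
abbrev IsoClass : Type (u + 1) := Skeleton (Var k)

/-- The product of isomorphism classes is `[X] * [Y] = [X ×_k Y]`. -/
instance isoClassCommMonoid : CommMonoid (IsoClass k) := Skeleton.instCommMonoid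

variable {k}

/-- A variety from a separated morphism of finite type to `Spec k`. -/
def Var.mk {X : Scheme.{u}} (s : X ⟶ Spec (CommRingCat.of k)) [IsSeparated s]
    [LocallyOfFiniteType s] [QuasiCompact s] : Var k :=
  ⟨Over.mk s, inferInstanceAs (IsSeparated s), inferInstanceAs (LocallyOfFiniteType s),
    inferInstanceAs (QuasiCompact s)⟩

/-- The underlying scheme of a variety. -/
abbrev Var.scheme (X : Var k) : Scheme.{u} := X.obj.left

/-- The structure morphism `X ⟶ Spec k` of a variety. -/
abbrev Var.str (X : Var k) : X.scheme ⟶ Spec (CommRingCat.of k) := X.obj.hom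

/-- The reduced variety `X_red` with the same underlying space as `X`. -/
def Var.red (X : Var k) : Var k :=
  haveI : IsSeparated X.str := X.property.1
  haveI : LocallyOfFiniteType X.str := X.property.2.1
  haveI : QuasiCompact X.str := X.property.2.2
  Var.mk (X.scheme.nilradical.subschemeι ≫ X.str)

variable (k) in
/-- The affine line `𝔸¹` over `k`. -/
def affineLine : Var k :=
  Var.mk (𝔸(ULift.{u} (Fin 1); Spec (CommRingCat.of k)) ↘ Spec (CommRingCat.of k))

/-- `X` is of pure dimension `d`: each irreducible component has Krull dimension `d`. -/
def Var.IsPureDim (X : Var k) (d : ℕ) : Prop :=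
  ∀ Z ∈ irreducibleComponents X.scheme, topologicalKrullDim Z = d

/-- `X` and `Y` are stably birational: `X × 𝔸ᵐ` and `Y × 𝔸ⁿ` are birational over `k` for
some `m` and `n`. -/
def StablyBirational (X Y : Var k) : Prop :=
  ∃ m n : ℕ, Scheme.BirationalOver
    (𝔸(ULift.{u} (Fin m); X.scheme) ↘ X.scheme ≫ X.str)
    (𝔸(ULift.{u} (Fin n); Y.scheme) ↘ Y.scheme ≫ Y.str)

end Varieties

section GrothendieckRing

variable (k : Type u) [Field k]

/-- The scissor relations `[X] - ([Y] + [U])` in the free abelian group on isomorphism classes,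
for `Y ⟶ X` a closed immersion and `U ⟶ X` an open immersion onto the complement `X \ Y`. -/
inductive ScissorRel : MonoidAlgebra ℤ (IsoClass k) → Prop
  | intro (X Y U : Var k) (i : Y.obj ⟶ X.obj) (j : U.obj ⟶ X.obj)
      [IsClosedImmersion i.left] [IsOpenImmersion j.left]
      (h : Set.range j.left = (Set.range i.left)ᶜ) :
      ScissorRel (MonoidAlgebra.of ℤ (IsoClass k) (toSkeleton X) -
        (MonoidAlgebra.of ℤ (IsoClass k) (toSkeleton Y) +
          MonoidAlgebra.of ℤ (IsoClass k) (toSkeleton U)))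

/-- The Grothendieck ring of varieties `K₀(Var_k)`: the free abelian group on isomorphism classes
of varieties, with multiplication induced by the product over `k`, modulo the scissor relations.
(Scissor relations are stable under the product with a variety, so that the ideal they generate
is the subgroup they generate.) -/
def K0 : Type (u + 1) :=
  MonoidAlgebra ℤ (IsoClass k) ⧸ Ideal.span {x | ScissorRel k x}

instance K0.commRing : CommRing (K0 k) :=
  inferInstanceAs (CommRing (MonoidAlgebra ℤ (IsoClass k) ⧸ Ideal.span {x | ScissorRel k x}))

variable {k}

/-- The class `[X]` in `K₀(Var_k)`. -/
def K0.cls (X : Var k) : K0 k :=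
  Ideal.Quotient.mk (Ideal.span {x | ScissorRel k x})
    (MonoidAlgebra.of ℤ (IsoClass k) (toSkeleton X))

variable (k) in
/-- The Lefschetz class `𝕃 = [𝔸¹]`. -/
def K0.lefschetz : K0 k := K0.cls (affineLine k)

/-- `X` is the disjoint union of the locally closed subvarieties `Z i`. -/
def IsLocallyClosedDecomposition (X : Var k) {n : ℕ} (Z : Fin n → Var k) : Prop :=
  ∃ f : ∀ i, (Z i).obj ⟶ X.obj,
    (∀ i, IsImmersion (f i).left) ∧
    (Pairwise fun i j => Disjoint (Set.range (f i).left) (Set.range (f j).left)) ∧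
    ⋃ i, Set.range (f i).left = Set.univ

variable (k) in
/-- The cut-and-paste conjecture for `k`: varieties with the same class in `K₀(Var_k)` can be
decomposed into pairwise isomorphic locally closed subvarieties. -/
def CutAndPaste : Prop :=
  ∀ X Y : Var k, K0.cls X = K0.cls Y →
    ∃ (n : ℕ) (Z W : Fin n → Var k),
      IsLocallyClosedDecomposition X Z ∧ IsLocallyClosedDecomposition Y W ∧
      ∀ i, Nonempty (Z i ≅ W i)

end GrothendieckRing

section Filtration

variable (k : Type u) [Field k]

/-- The localization `K₀(Var_k)[𝕃⁻¹]`. -/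
abbrev K0Loc : Type (u + 1) := Localization.Away (K0.lefschetz k)

variable {k}

/-- The element `[X] / 𝕃ʳ` of `K₀(Var_k)[𝕃⁻¹]`. -/
def frac (X : Var k) (r : ℕ) : K0Loc k :=
  Localization.mk (K0.cls X) ⟨K0.lefschetz k ^ r, r, rfl⟩

variable (k) in
/-- The dimension filtration: `Fⁱ` is the additive subgroup of `K₀(Var_k)[𝕃⁻¹]` generated by the
elements `[S] / 𝕃ʳ` with `S` of pure dimension at most `i + r`. -/
def dimFiltration (i : ℤ) : AddSubgroup (K0Loc k) :=
  AddSubgroup.closure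
    {x | ∃ (S : Var k) (r d : ℕ), S.IsPureDim d ∧ (d : ℤ) ≤ i + r ∧ x = frac S r}

variable (k) in
/-- The quotient `F⁰ / F⁻¹` of the dimension filtration. -/
abbrev Gr0 : Type (u + 1) :=
  dimFiltration k 0 ⧸ (dimFiltration k (-1)).addSubgroupOf (dimFiltration k 0)

theorem Var.isPureDim_of_irreducible (X : Var k) [IrreducibleSpace X.scheme] {d : ℕ}
    (hd : topologicalKrullDim X.scheme = d) : X.IsPureDim d := by
  intro Z hZ
  rw [irreducibleComponents_eq_singleton, Set.mem_singleton_iff] at hZ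
  subst hZ
  rw [← hd]
  exact IsHomeomorph.topologicalKrullDim_eq _ (Homeomorph.Set.univ X.scheme).isHomeomorph

theorem frac_mem_dimFiltration_zero (X : Var k) [IrreducibleSpace X.scheme] {d : ℕ}
    (hd : topologicalKrullDim X.scheme = d) : frac X d ∈ dimFiltration k 0 :=
  AddSubgroup.subset_closure ⟨X, d, d, X.isPureDim_of_irreducible hd, by simp, rfl⟩

/-- The class of `[X] / 𝕃ᵈ` in `F⁰ / F⁻¹`, for an irreducible variety `X` of dimension `d`. -/
def normalizedClass (X : Var k) [IrreducibleSpace X.scheme] {d : ℕ}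
    (hd : topologicalKrullDim X.scheme = d) : Gr0 k :=
  QuotientAddGroup.mk ⟨frac X d, frac_mem_dimFiltration_zero X hd⟩

end Filtration

end MotivicK0

end

/-! Multiplying an element of `F⁻¹` by a large power `𝕃ᴺ⁺¹` turns it into a difference `[P] - [Q]`
with `P` and `Q` of dimension at most `N` (`exists_eq_sub_of_mem_dimFiltration`). Applied to `[X]/𝕃ᵈ
- [Y]/𝕃ᵉ`, and after one more power of `𝕃` to leave the localization, this gives `[𝔸ᵃ × X ⊔ Q] = [𝔸ᵇ
× Y ⊔ P]` in `K₀(Var_k)`, where both affine spaces have dimension `N + 1` and the added terms have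
dimension at most `N` (`exists_cls_coprod_eq`).

Cut-and-paste now decomposes both sides into isomorphic pieces. The piece through the generic point
of `𝔸ᵃ × X` contains a nonempty open subset of it, of dimension `N + 1`. Its copy on the other side
is too big for `P` and for any proper closed subset of `𝔸ᵇ × Y`, so it reaches the generic point of
`𝔸ᵇ × Y`. Hence nonempty opens of the two affine spaces are isomorphic
(`birationalOver_of_cls_coprod_eq`). This argument needs `X` and `Y` integral; the irreducible case
follows because `[X_red] = [X]`.

The rest is dimension theory: `𝔸ⁿ` adds `n` to the dimension, and nonempty opens of an integral
variety have full dimension. -/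

/-! ### Krull dimension of domains of finite type over a field. -/

theorem ringKrullDim_le_of_isIntegral {R S : Type*} [CommRing R] [CommRing S] [Algebra R S]
    [Algebra.IsIntegral R S] : ringKrullDim S ≤ ringKrullDim R :=
  Order.krullDim_le_of_strictMono (PrimeSpectrum.comap (algebraMap R S)) fun _ _ h ↦
    Ideal.IsIntegral.comap_lt_comap h

/-- Lying over gives a prime above the bottom of a chain, and going up lifts the rest. -/
theorem ringKrullDim_le_of_isIntegral_of_injective {R S : Type*} [CommRing R] [CommRing S]
    [Algebra R S] [Algebra.IsIntegral R S] (h : Function.Injective (algebraMap R S)) :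
    ringKrullDim R ≤ ringKrullDim S := by
  refine iSup_le fun l ↦ ?_
  obtain ⟨Q, -, hQ, hQl⟩ := Ideal.exists_ideal_over_prime_of_isIntegral l.head.asIdeal (⊥ : Ideal S)
    (by rw [← RingHom.ker_eq_comap_bot, (RingHom.injective_iff_ker_eq_bot _).1 h]; exact bot_le)
  have : Q.LiesOver l.head.asIdeal := ⟨hQl.symm⟩
  obtain ⟨L, hL, -⟩ := Ideal.exists_ltSeries_of_hasGoingUp l Q
  rw [← hL]
  exact Order.LTSeries.length_le_krullDim L

/-- For a domain of finite type over a field, the Krull dimension is the transcendence degree. -/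
theorem ringKrullDim_eq_trdeg (k A : Type*) [Field k] [CommRing A] [IsDomain A] [Algebra k A]
    [Algebra.FiniteType k A] : ∃ n : ℕ, ringKrullDim A = n ∧ Algebra.trdeg k A = n := by
  -- Noether normalization: both invariants equal the number of polynomial variables.
  obtain ⟨n, g, hg, hint⟩ := exists_integral_inj_algHom_of_fg k A
  let := g.toRingHom.toAlgebra
  have : IsScalarTower k (MvPolynomial (Fin n) k) A := .of_algebraMap_eq' g.comp_algebraMap.symm
  have hint' : Algebra.IsIntegral (MvPolynomial (Fin n) k) A := ⟨hint⟩
  have : FaithfulSMul (MvPolynomial (Fin n) k) A :=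
    (faithfulSMul_iff_algebraMap_injective _ _).2 hg
  refine ⟨n, ?_, ?_⟩
  · rw [le_antisymm (ringKrullDim_le_of_isIntegral (R := MvPolynomial (Fin n) k))
      (ringKrullDim_le_of_isIntegral_of_injective hg),
      MvPolynomial.ringKrullDim_of_isNoetherianRing]
    simp
  · have hb := (IsTranscendenceBasis.mvPolynomial (Fin n) k)
    have h := lift_trdeg_add_eq k (MvPolynomial (Fin n) k) A
    rw [trdeg_eq_zero_iff.2 hint'.isAlgebraic, MvPolynomial.trdeg_of_isDomain] at h
    simpa using h.symm

/-- Transcendence degree is monotone along injections, whether or not they are integral; this covers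
localizations. -/
theorem ringKrullDim_le_of_finiteType_of_injective (k : Type*) {A B : Type*} [Field k]
    [CommRing A] [IsDomain A] [Algebra k A] [Algebra.FiniteType k A]
    [CommRing B] [IsDomain B] [Algebra k B] [Algebra.FiniteType k B]
    (f : A →ₐ[k] B) (hf : Function.Injective f) : ringKrullDim A ≤ ringKrullDim B := by
  obtain ⟨n, hn, hn'⟩ := ringKrullDim_eq_trdeg k A
  obtain ⟨m, hm, hm'⟩ := ringKrullDim_eq_trdeg k B
  have := lift_trdeg_le_of_injective f hf
  rw [hn', hm', Cardinal.lift_natCast, Cardinal.lift_natCast] at this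
  rw [hn, hm]
  exact_mod_cast this

/-! ### Dimension of topological spaces: open covers, components, proper closed subsets. -/

section Topology

open TopologicalSpace Topology

/-- Every irreducible closed set containing `Z` also meets the open set, and those meeting it
correspond to irreducible closed subsets of `U`. -/
theorem coheight_le_topologicalKrullDim_of_isOpenEmbedding {X U : Type*} [TopologicalSpace X]
    [TopologicalSpace U] {f : U → X} (hf : IsOpenEmbedding f) (Z : IrreducibleCloseds X) {u : U}
    (hu : f u ∈ (Z : Set X)) : Order.coheight Z ≤ topologicalKrullDim U := by
  let Z' : {V : IrreducibleCloseds X // (f ⁻¹' V).Nonempty} := ⟨Z, u, hu⟩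
  have : IrreducibleCloseds.map f hf.continuous
      ((IrreducibleCloseds.orderIsoOfIsOpenEmbedding f hf).symm Z') = Z :=
    congr_arg Subtype.val ((IrreducibleCloseds.orderIsoOfIsOpenEmbedding f hf).apply_symm_apply Z')
  rw [← this, hf.coheight_map]
  exact Order.coheight_le_krullDim _

theorem topologicalKrullDim_le_of_isOpenEmbedding {X : Type*} [TopologicalSpace X]
    {n : WithBot ℕ∞}
    (h : ∀ x : X, ∃ (U : Type _) (_ : TopologicalSpace U) (f : U → X),
      IsOpenEmbedding f ∧ x ∈ Set.range f ∧ topologicalKrullDim U ≤ n) :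
    topologicalKrullDim X ≤ n := by
  rw [topologicalKrullDim, Order.krullDim_eq_iSup_coheight]
  refine iSup_le fun Z ↦ ?_
  obtain ⟨x, hx⟩ := Z.isIrreducible.nonempty
  obtain ⟨U, _, f, hf, ⟨u, rfl⟩, hU⟩ := h x
  exact (coheight_le_topologicalKrullDim_of_isOpenEmbedding hf Z hx).trans hU

/-- Any point of the smallest member of a chain of length `n` will do: the whole chain survives in
each open neighbourhood of it. -/
theorem exists_le_topologicalKrullDim_of_isOpenEmbedding {X : Type*} [TopologicalSpace X]
    {n : ℕ} (h : n ≤ topologicalKrullDim X) :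
    ∃ x : X, ∀ (U : Type _) [TopologicalSpace U] (f : U → X),
      IsOpenEmbedding f → x ∈ Set.range f → n ≤ topologicalKrullDim U := by
  obtain ⟨l, rfl⟩ := Order.le_krullDim_iff.1 h
  obtain ⟨x, hx⟩ := l.head.isIrreducible.nonempty
  refine ⟨x, fun U _ f hf ⟨u, hu⟩ ↦ ?_⟩
  refine le_trans ?_
    (coheight_le_topologicalKrullDim_of_isOpenEmbedding hf l.head (u := u) (by rwa [hu]))
  exact_mod_cast Order.length_le_coheight_head

theorem Topology.IsInducing.isIrreducible_preimage {X Y : Type*} [TopologicalSpace X]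
    [TopologicalSpace Y] {f : Y → X} (hf : IsInducing f) {s : Set X} (hs : IsIrreducible s)
    (h : s ⊆ Set.range f) : IsIrreducible (f ⁻¹' s) := by
  refine ⟨hs.nonempty.preimage' h, fun u v hu hv ↦ ?_⟩
  obtain ⟨u, hu', rfl⟩ := hf.isOpen_iff.1 hu
  obtain ⟨v, hv', rfl⟩ := hf.isOpen_iff.1 hv
  rintro ⟨x, hx, hxu⟩ ⟨y, hy, hyv⟩
  obtain ⟨z, hz, hzuv⟩ := hs.isPreirreducible u v hu' hv' ⟨_, hx, hxu⟩ ⟨_, hy, hyv⟩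
  obtain ⟨z, rfl⟩ := h hz
  exact ⟨z, hz, hzuv⟩

/-- The largest member of a chain lies in some component, and with it the whole chain. -/
theorem topologicalKrullDim_le_of_irreducibleComponents {X : Type*} [TopologicalSpace X]
    {n : WithBot ℕ∞} (h : ∀ Z ∈ irreducibleComponents X, topologicalKrullDim Z ≤ n) :
    topologicalKrullDim X ≤ n := by
  refine iSup_le fun l ↦ ?_
  obtain ⟨Z, hZ, hl⟩ := exists_mem_irreducibleComponents_subset_of_isIrreducible _
    l.last.isIrreducible
  refine le_trans ?_ (h Z hZ)
  have hZc := (isClosed_of_mem_irreducibleComponents Z hZ).isClosedEmbedding_subtypeVal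
  let L : LTSeries (IrreducibleCloseds Z) :=
    { length := l.length
      toFun i := ⟨Subtype.val ⁻¹' (l i : Set X),
        hZc.isInducing.isIrreducible_preimage (l i).isIrreducible (by
          rw [Subtype.range_coe]; exact le_trans (l.monotone (Fin.le_last i)) hl),
        (l i).isClosed.preimage continuous_subtype_val⟩
      step i := by
        obtain ⟨hle, hnot⟩ := l.step i
        refine ⟨fun x hx ↦ hle hx, fun h ↦ hnot fun x hx ↦ ?_⟩
        exact @h ⟨x, hl (l.monotone (Fin.le_last i.succ) hx)⟩ hx }
  exact Order.LTSeries.length_le_krullDim L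

/-- A chain in `C` can be prolonged by `X` itself; finiteness of the bound makes the inequality
strict. -/
theorem topologicalKrullDim_le_of_ssubset {X : Type*} [TopologicalSpace X] [IrreducibleSpace X]
    {n : ℕ} (hX : topologicalKrullDim X ≤ n) {C : Set X} (hC : IsClosed C) (hne : C ≠ Set.univ) :
    topologicalKrullDim C < n := by
  refine Order.krullDim_lt_coe_iff.2 fun l ↦ ?_
  let L := l.map (IrreducibleCloseds.map (Subtype.val : C → X) continuous_subtype_val)
    (IrreducibleCloseds.map_strictMono_of_isInducing IsInducing.subtypeVal)
  let T : IrreducibleCloseds X := ⟨Set.univ, IrreducibleSpace.isIrreducible_univ X, isClosed_univ⟩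
  have hlt : L.last < T := by
    refine lt_of_le_of_ne (fun _ _ ↦ trivial) fun h ↦ hne ?_
    have h' : (L.last : Set X) = Set.univ := congr_arg _ h
    rw [Set.eq_univ_iff_forall] at h' ⊢
    refine fun x ↦ closure_minimal ?_ hC (h' x)
    rintro _ ⟨y, -, rfl⟩
    exact y.2
  have := (Order.LTSeries.length_le_krullDim (L.snoc T hlt)).trans hX
  have : L.length + 1 ≤ n := by exact_mod_cast this
  exact this

end Topology

/-! ### Dimension of affine spaces and of open subsets of integral varieties. -/

section

open Limits

theorem AffineSpace.topologicalKrullDim_Spec (n : Type u) [Finite n] (R : CommRingCat.{u})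
    [IsNoetherianRing R] :
    topologicalKrullDim 𝔸(n; Spec R) = topologicalKrullDim (Spec R) + Nat.card n := by
  rw [IsHomeomorph.topologicalKrullDim_eq _ (AffineSpace.SpecIso n R).hom.homeomorph.isHomeomorph]
  exact (PrimeSpectrum.topologicalKrullDim_eq_ringKrullDim _).trans
    ((MvPolynomial.ringKrullDim_of_isNoetherianRing).trans
      (congr_arg (· + _) (PrimeSpectrum.topologicalKrullDim_eq_ringKrullDim _).symm))

theorem AffineSpace.mem_range_map (n : Type u) {X Y : Scheme.{u}} (f : Y ⟶ X) (a : 𝔸(n; X))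
    (h : (𝔸(n; X) ↘ X) a ∈ Set.range f) : a ∈ Set.range (AffineSpace.map n f) := by
  obtain ⟨y, hy⟩ := h
  obtain ⟨z, hz, -⟩ := Scheme.Pullback.exists_preimage_pullback a y hy.symm
  refine ⟨(AffineSpace.isPullback_map (n := n) f).isoPullback.inv z, ?_⟩
  rw [← Scheme.Hom.comp_apply, IsPullback.isoPullback_inv_fst, hz]

instance AffineSpace.isOpenImmersion_map (n : Type u) {X Y : Scheme.{u}} (f : Y ⟶ X)
    [IsOpenImmersion f] : IsOpenImmersion (AffineSpace.map n f) :=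
  MorphismProperty.of_isPullback (AffineSpace.isPullback_map f).flip ‹_›

theorem isNoetherianRing_of_isOpenImmersion {X : Scheme.{u}} [IsLocallyNoetherian X]
    {R : CommRingCat.{u}} (f : Spec R ⟶ X) [IsOpenImmersion f] : IsNoetherianRing R :=
  isLocallyNoetherian_Spec.mp (isLocallyNoetherian_of_isOpenImmersion f)

theorem AffineSpace.topologicalKrullDim_le (n : Type u) [Finite n] (X : Scheme.{u})
    [IsLocallyNoetherian X] {d : ℕ} (h : topologicalKrullDim X ≤ d) :
    topologicalKrullDim 𝔸(n; X) ≤ (d + Nat.card n : ℕ) := by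
  refine topologicalKrullDim_le_of_isOpenEmbedding fun a ↦ ?_
  obtain ⟨R, f, _, hx, -⟩ := Scheme.exists_affine_mem_range_and_range_subset
    (show (𝔸(n; X) ↘ X) a ∈ (⊤ : X.Opens) from trivial)
  have := isNoetherianRing_of_isOpenImmersion f
  refine ⟨_, _, AffineSpace.map n f, (AffineSpace.map n f).isOpenEmbedding,
    AffineSpace.mem_range_map n f a hx, ?_⟩
  rw [AffineSpace.topologicalKrullDim_Spec, Nat.cast_add]
  gcongr
  exact (f.isOpenEmbedding.isInducing.topologicalKrullDim_le).trans h

theorem AffineSpace.le_topologicalKrullDim (n : Type u) [Finite n] (X : Scheme.{u})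
    [IsLocallyNoetherian X] {d : ℕ} (h : d ≤ topologicalKrullDim X) :
    (d + Nat.card n : ℕ) ≤ topologicalKrullDim 𝔸(n; X) := by
  obtain ⟨x, hx⟩ := exists_le_topologicalKrullDim_of_isOpenEmbedding h
  obtain ⟨R, f, _, hxf, -⟩ := Scheme.exists_affine_mem_range_and_range_subset
    (show x ∈ (⊤ : X.Opens) from trivial)
  have := isNoetherianRing_of_isOpenImmersion f
  refine le_trans ?_ (AffineSpace.map n f).isOpenEmbedding.isInducing.topologicalKrullDim_le
  rw [AffineSpace.topologicalKrullDim_Spec, Nat.cast_add]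
  gcongr
  exact hx _ f f.isOpenEmbedding hxf

/-- Finite type over a field is essential: the generic point of a discrete valuation ring is open of
smaller dimension. In an affine chart `Spec R`, the open set contains some `D(g)` with `g ≠ 0`, and
`R → R_g` is an injection of domains of finite type over `k`. -/
theorem topologicalKrullDim_le_of_isOpen {k : Type u} [Field k] {E : Scheme.{u}} [IsIntegral E]
    (s : E ⟶ Spec (CommRingCat.of k)) [LocallyOfFiniteType s] {U : Set E} (hU : IsOpen U)
    (hne : U.Nonempty) : topologicalKrullDim E ≤ topologicalKrullDim U := by
  refine topologicalKrullDim_le_of_isOpenEmbedding fun x ↦ ?_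
  obtain ⟨R, f, _, hx, -⟩ := Scheme.exists_affine_mem_range_and_range_subset
    (show x ∈ (⊤ : E.Opens) from trivial)
  refine ⟨_, _, f, f.isOpenEmbedding, hx, ?_⟩
  have : Nonempty (Spec R) := ⟨hx.choose⟩
  have : IsIntegral (Spec R) := isIntegral_of_isOpenImmersion f
  have : IsDomain R := (affine_isIntegral_iff R).1 this
  obtain ⟨φ, hφ⟩ := Spec.map_surjective (f ≫ s)
  have hft : LocallyOfFiniteType (Spec.map φ) := hφ ▸ inferInstance
  replace hft : φ.hom.FiniteType := HasRingHomProperty.Spec_iff.1 hft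
  let : Algebra k R := φ.hom.toAlgebra
  have : Algebra.FiniteType k R := hft
  -- The chart around `x` meets `U` because `E` is irreducible.
  obtain ⟨_, ⟨p, rfl⟩, hpU⟩ := nonempty_preirreducible_inter f.isOpenEmbedding.isOpen_range hU
    (Set.range_nonempty f) hne
  obtain ⟨_, ⟨g, rfl⟩, hpg, hgU⟩ :=
    PrimeSpectrum.isTopologicalBasis_basic_opens.exists_subset_of_mem_open
    (show p ∈ f ⁻¹' U from hpU) (hU.preimage f.continuous)
  have hg : g ≠ 0 := by
    rintro rfl
    exact hpg (zero_mem _)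
  have hle : Submonoid.powers g ≤ nonZeroDivisors R :=
    powers_le_nonZeroDivisors_of_noZeroDivisors hg
  have : IsDomain (Localization.Away g) := IsLocalization.isDomain_localization hle
  have : Algebra.FiniteType R (Localization.Away g) :=
    IsLocalization.finiteType_of_monoid_fg (.powers g) _
  have : Algebra.FiniteType k (Localization.Away g) := .trans (S := R) inferInstance inferInstance
  have hdim := ringKrullDim_le_of_finiteType_of_injective k
    (IsScalarTower.toAlgHom k R (Localization.Away g)) (IsLocalization.injective _ hle)
  have hemb := PrimeSpectrum.localization_away_isOpenEmbedding (Localization.Away g) g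
  have hrange := PrimeSpectrum.localization_away_comap_range (Localization.Away g) g
  let F : PrimeSpectrum (Localization.Away g) → U := fun q ↦
    ⟨f (PrimeSpectrum.comap (algebraMap R (Localization.Away g)) q), hgU (hrange.subset ⟨q, rfl⟩)⟩
  have hF : Topology.IsInducing F :=
    (f.isOpenEmbedding.isInducing.comp hemb.isInducing).codRestrict _
  calc topologicalKrullDim (Spec R) = ringKrullDim R :=
        PrimeSpectrum.topologicalKrullDim_eq_ringKrullDim _
    _ ≤ _ := hdim
    _ = _ := (PrimeSpectrum.topologicalKrullDim_eq_ringKrullDim _).symm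
    _ ≤ _ := hF.topologicalKrullDim_le

end

/-! ### Immersions through a generic point, and disjoint unions of schemes. -/

section

open Limits

/-- An immersion into an integral scheme whose image contains the generic point is an open
immersion. -/
theorem isOpenImmersion_of_genericPoint_mem_range {Z E : Scheme.{u}} [IsIntegral E] (f : Z ⟶ E)
    [IsImmersion f] (h : genericPoint E ∈ Set.range f) : IsOpenImmersion f := by
  obtain ⟨z, hz⟩ := h
  have : Nonempty f.coborderRange := ⟨f.liftCoborder z⟩
  have : IsIntegral f.coborderRange := isIntegral_of_isOpenImmersion f.coborderRange.ι
  have hgen : f.liftCoborder z = genericPoint f.coborderRange := by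
    apply f.coborderRange.ι.isOpenEmbedding.injective
    rw [genericPoint_eq_of_isOpenImmersion, ← Scheme.Hom.comp_apply, Scheme.Hom.liftCoborder_ι, hz]
  have : Surjective f.liftCoborder := ⟨by
    rw [← Set.range_eq_univ, Set.eq_univ_iff_forall]
    intro x
    exact (genericPoint_specializes x).mem_closed f.liftCoborder.isClosedEmbedding.isClosed_range
      ⟨z, hgen⟩⟩
  -- A surjective closed immersion into a reduced scheme is an isomorphism, so `f` is the inclusion
  -- of its coborder up to isomorphism.
  have := isIso_of_isClosedImmersion_of_surjective f.liftCoborder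
  rw [← f.liftCoborder_ι]
  infer_instance

/-- Near a point lying over the generic point of an integral open subscheme `E` of `T`, an
immersion into `T` is an open immersion into `E`. -/
theorem exists_isOpenImmersion_of_genericPoint {Z T E : Scheme.{u}} [IsIntegral E] (f : Z ⟶ T)
    [IsImmersion f] (j : E ⟶ T) [IsOpenImmersion j] {z : Z} (hz : f z = j (genericPoint E)) :
    ∃ (V : Z.Opens) (g : V.toScheme ⟶ E), z ∈ V ∧ IsOpenImmersion g ∧ g ≫ j = V.ι ≫ f := by
  let V := f ⁻¹ᵁ j.opensRange
  let g : V.toScheme ⟶ E := IsOpenImmersion.lift j (V.ι ≫ f) (by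
    rintro _ ⟨v, rfl⟩
    exact v.2)
  have hg : g ≫ j = V.ι ≫ f := IsOpenImmersion.lift_fac _ _ _
  have : IsImmersion (g ≫ j) := hg ▸ inferInstance
  have : IsImmersion g := .of_comp g j
  have hzV : z ∈ V := ⟨genericPoint E, hz.symm⟩
  have hgz (v : V.toScheme) : j (g v) = f (V.ι v) := by
    rw [← Scheme.Hom.comp_apply, ← Scheme.Hom.comp_apply, hg]
  exact ⟨V, g, hzV, isOpenImmersion_of_genericPoint_mem_range g
    ⟨⟨z, hzV⟩, j.isOpenEmbedding.injective ((hgz ⟨z, hzV⟩).trans hz)⟩, hg⟩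

/-- Properties local at the target pass to `coprod.map`, leaving only the fold map `S ⨿ S ⟶ S` to
check. -/
theorem Scheme.coprodDesc_eq {X Y S : Scheme.{u}} (f : X ⟶ S) (g : Y ⟶ S) :
    coprod.desc f g = coprod.map f g ≫ coprod.desc (𝟙 S) (𝟙 S) := by
  simp

instance {X Y S : Scheme.{u}} (f : X ⟶ S) (g : Y ⟶ S) [IsSeparated f] [IsSeparated g] :
    IsSeparated (coprod.desc f g) := by
  have : IsSeparated (coprod.map f g) := IsZariskiLocalAtTarget.coprodMap _ _ ‹_› ‹_›
  rw [Scheme.coprodDesc_eq]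
  infer_instance

theorem quasiCompact_coprodDesc {X Y S : Scheme.{u}} [IsAffine S] (f : X ⟶ S) (g : Y ⟶ S)
    [QuasiCompact f] [QuasiCompact g] : QuasiCompact (coprod.desc f g) := by
  have := QuasiCompact.compactSpace_of_compactSpace f
  have := QuasiCompact.compactSpace_of_compactSpace g
  exact (quasiCompact_iff_compactSpace _).2 (coprodMk X Y).compactSpace

instance {X Y S : Scheme.{u}} (f : X ⟶ S) (g : Y ⟶ S) [h : LocallyOfFiniteType f]
    [h' : LocallyOfFiniteType g] : LocallyOfFiniteType (coprod.desc f g) := by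
  let P : MorphismProperty Scheme.{u} := @LocallyOfFiniteType
  have : HasRingHomProperty P RingHom.FiniteType :=
    instHasRingHomPropertyLocallyOfFiniteTypeFiniteType
  have : LocallyOfFiniteType (coprod.map f g) :=
    IsZariskiLocalAtTarget.coprodMap (P := P) f g h h'
  rw [Scheme.coprodDesc_eq]
  infer_instance

instance {X Y : Scheme.{u}} : IsClosedImmersion (coprod.inl : X ⟶ X ⨿ Y) := by
  apply IsClosedImmersion.of_isPreimmersion
  rw [← (isCompl_range_inl_inr X Y).symm.compl_eq]
  exact (coprod.inr : Y ⟶ X ⨿ Y).isOpenEmbedding.isOpen_range.isClosed_compl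

theorem topologicalKrullDim_coprod_le {X Y : Scheme.{u}} {n : WithBot ℕ∞}
    (hX : topologicalKrullDim X ≤ n) (hY : topologicalKrullDim Y ≤ n) :
    topologicalKrullDim (X ⨿ Y : Scheme.{u}) ≤ n := by
  refine topologicalKrullDim_le_of_isOpenEmbedding fun x ↦ ?_
  have : x ∈ Set.range (coprod.inl : X ⟶ X ⨿ Y) ∪ Set.range (coprod.inr : Y ⟶ X ⨿ Y) := by
    exact (isCompl_range_inl_inr X Y).sup_eq_top.ge trivial
  rcases this with h | h
  · exact ⟨_, _, _, (coprod.inl : X ⟶ X ⨿ Y).isOpenEmbedding, h, hX⟩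
  · exact ⟨_, _, _, (coprod.inr : Y ⟶ X ⨿ Y).isOpenEmbedding, h, hY⟩

end

/-! ### Iterated affine spaces and computations in `K₀(Var_k)`. -/

noncomputable section

open AffineSpace in
/-- `𝔸ᵐ⁺ⁿ = 𝔸ⁿ × 𝔸ᵐ` over any base. -/
def AffineSpace.sumIso (m n : Type u) (S : Scheme.{u}) : 𝔸(m ⊕ n; S) ≅ 𝔸(n; 𝔸(m; S)) where
  hom := homOfVector (homOfVector (𝔸(m ⊕ n; S) ↘ S) fun i ↦ coord S (.inl i))
    fun i ↦ coord S (.inr i)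
  inv := homOfVector (𝔸(n; 𝔸(m; S)) ↘ 𝔸(m; S) ≫ 𝔸(m; S) ↘ S)
    (Sum.elim (fun i ↦ (𝔸(n; 𝔸(m; S)) ↘ 𝔸(m; S)).appTop (coord S i)) fun i ↦ coord _ i)
  hom_inv_id := by
    apply hom_ext
    · simp only [Category.assoc, homOfVector_over, homOfVector_over_assoc, Category.id_comp]
    · rintro (i | i)
      · rw [Scheme.Hom.comp_appTop, CommRingCat.comp_apply, homOfVector_appTop_coord,
          Sum.elim_inl, ← CommRingCat.comp_apply, ← Scheme.Hom.comp_appTop, homOfVector_over,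
          homOfVector_appTop_coord]
        rfl
      · rw [Scheme.Hom.comp_appTop, CommRingCat.comp_apply, homOfVector_appTop_coord,
          Sum.elim_inr, homOfVector_appTop_coord]
        rfl
  inv_hom_id := by
    apply hom_ext
    · apply hom_ext
      · simp only [Category.assoc, homOfVector_over, Category.id_comp]
      · intro i
        rw [Category.assoc, homOfVector_over, Category.id_comp, Scheme.Hom.comp_appTop,
          CommRingCat.comp_apply, homOfVector_appTop_coord, homOfVector_appTop_coord,
          Sum.elim_inl]
    · intro i
      rw [Scheme.Hom.comp_appTop, CommRingCat.comp_apply, homOfVector_appTop_coord,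
        homOfVector_appTop_coord, Sum.elim_inr]
      rfl

theorem AffineSpace.sumIso_hom_over (m n : Type u) (S : Scheme.{u}) :
    (AffineSpace.sumIso m n S).hom ≫ 𝔸(n; 𝔸(m; S)) ↘ 𝔸(m; S) ≫ 𝔸(m; S) ↘ S =
      𝔸(m ⊕ n; S) ↘ S := by
  simp only [AffineSpace.sumIso, AffineSpace.homOfVector_over, AffineSpace.homOfVector_over_assoc]

/-- Affine spaces with equipotent sets of coordinates are isomorphic. -/
def AffineSpace.reindexIso {m n : Type u} (e : m ≃ n) (S : Scheme.{u}) : 𝔸(n; S) ≅ 𝔸(m; S) where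
  hom := AffineSpace.reindex e S
  inv := AffineSpace.reindex e.symm S
  hom_inv_id := by
    apply AffineSpace.hom_ext
    · simp
    · intro i
      rw [Scheme.Hom.comp_appTop, CommRingCat.comp_apply, AffineSpace.reindex_appTop_coord,
        AffineSpace.reindex_appTop_coord, e.apply_symm_apply]
      rfl
  inv_hom_id := by
    apply AffineSpace.hom_ext
    · simp
    · intro i
      rw [Scheme.Hom.comp_appTop, CommRingCat.comp_apply, AffineSpace.reindex_appTop_coord,
        AffineSpace.reindex_appTop_coord, e.symm_apply_apply]
      rfl

namespace MotivicK0
open Limits MonoidalCategory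
variable {k : Type u} [Field k]

attribute [local instance] Over.cartesianMonoidalCategory Over.braidedCategory

instance (X : Var k) : IsSeparated X.str := X.property.1
instance (X : Var k) : LocallyOfFiniteType X.str := X.property.2.1
instance (X : Var k) : QuasiCompact X.str := X.property.2.2

instance (X : Var k) : IsLocallyNoetherian X.scheme :=
  LocallyOfFiniteType.isLocallyNoetherian X.str

namespace Var

/-- An isomorphism of varieties from an isomorphism of schemes over `k`. -/
def isoMk {X Y : Var k} (e : X.scheme ≅ Y.scheme) (h : e.hom ≫ Y.str = X.str) : X ≅ Y :=
  (isVariety k).isoMk (Over.isoMk e h)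

/-- The disjoint union of two varieties. -/
def coprod (X Y : Var k) : Var k :=
  haveI := quasiCompact_coprodDesc X.str Y.str
  Var.mk (coprod.desc X.str Y.str)

/-- The affine space `𝔸ⁿ × X` over a variety `X`. -/
def affineSpace (n : ℕ) (X : Var k) : Var k :=
  Var.mk (𝔸(ULift.{u} (Fin n); X.scheme) ↘ X.scheme ≫ X.str)

variable (k) in
/-- The empty variety. -/
def empty : Var k :=
  Var.mk (Scheme.emptyTo (Spec (CommRingCat.of k)))

/-- `𝔸⁰ × X = X`. -/
def affineSpaceZeroIso (X : Var k) : affineSpace 0 X ≅ X :=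
  let e : 𝔸(ULift.{u} (Fin 0); X.scheme) ≅ X.scheme :=
    asIso (𝔸(ULift.{u} (Fin 0); X.scheme) ↘ X.scheme)
  isoMk e rfl

/-- `𝔸¹ × X = X × 𝔸¹`. -/
def affineSpaceOneIso (X : Var k) : affineSpace 1 X ≅ X ⊗ affineLine k :=
  isoMk (AffineSpace.isPullback_map (n := ULift.{u} (Fin 1)) X.str).flip.isoPullback (by
    exact (AffineSpace.isPullback_map (n := ULift.{u} (Fin 1)) X.str).flip.isoPullback_hom_fst_assoc
      X.str)

/-- `𝔸ᵐ⁺ⁿ × X = 𝔸ⁿ × 𝔸ᵐ × X`. -/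
def affineSpaceAddIso (m n : ℕ) (X : Var k) :
    affineSpace (m + n) X ≅ affineSpace n (affineSpace m X) :=
  let e : ULift.{u} (Fin m) ⊕ ULift.{u} (Fin n) ≃ ULift.{u} (Fin (m + n)) :=
    (Equiv.sumCongr Equiv.ulift Equiv.ulift).trans (finSumFinEquiv.trans Equiv.ulift.symm)
  isoMk (AffineSpace.reindexIso e X.scheme ≪≫ AffineSpace.sumIso _ _ X.scheme) (by
    change (AffineSpace.reindex e X.scheme ≫ (AffineSpace.sumIso _ _ X.scheme).hom) ≫
      (𝔸(_; 𝔸(_; X.scheme)) ↘ 𝔸(_; X.scheme)) ≫ (𝔸(_; X.scheme) ↘ X.scheme) ≫ X.str =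
      𝔸(_; X.scheme) ↘ X.scheme ≫ X.str
    have := AffineSpace.sumIso_hom_over (ULift.{u} (Fin m)) (ULift.{u} (Fin n)) X.scheme
    rw [← AffineSpace.reindex_over e X.scheme, ← this]
    simp only [Category.assoc]
    rfl)

end Var

namespace K0

theorem cls_eq_of_iso {X Y : Var k} (e : X ≅ Y) : cls X = cls Y := by
  have : toSkeleton X = toSkeleton Y := Quotient.sound ⟨e⟩
  rw [cls, this, cls]

theorem cls_tensor (X Y : Var k) : cls (X ⊗ Y) = cls X * cls Y := by
  rw [cls, Skeleton.toSkeleton_tensorObj, map_mul, map_mul]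
  rfl

theorem cls_mk_eq_add {X Y U : Scheme.{u}} (s : X ⟶ Spec (CommRingCat.of k)) [IsSeparated s]
    [LocallyOfFiniteType s] [QuasiCompact s] (t : Y ⟶ Spec (CommRingCat.of k)) [IsSeparated t]
    [LocallyOfFiniteType t] [QuasiCompact t] (r : U ⟶ Spec (CommRingCat.of k)) [IsSeparated r]
    [LocallyOfFiniteType r] [QuasiCompact r] (i : Y ⟶ X) [IsClosedImmersion i] (j : U ⟶ X)
    [IsOpenImmersion j] (hi : i ≫ s = t) (hj : j ≫ s = r) (h : Set.range j = (Set.range i)ᶜ) :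
    cls (Var.mk s) = cls (Var.mk t) + cls (Var.mk r) := by
  let i' : (Var.mk t).obj ⟶ (Var.mk s).obj := Over.homMk i hi
  let j' : (Var.mk r).obj ⟶ (Var.mk s).obj := Over.homMk j hj
  have : IsClosedImmersion i'.left := ‹_›
  have : IsOpenImmersion j'.left := ‹_›
  rw [← sub_eq_zero]
  exact Ideal.Quotient.eq_zero_iff_mem.2 (Ideal.subset_span (ScissorRel.intro _ _ _ i' j' h))

/-- The empty scheme is the complement of itself, so `[∅] = [∅] + [∅]`. -/
theorem cls_of_isEmpty (X : Var k) [IsEmpty X.scheme] : cls X = 0 := by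
  have : cls X = cls X + cls X := cls_mk_eq_add X.str X.str X.str (𝟙 _) (𝟙 _)
    (Category.id_comp _) (Category.id_comp _) (Subsingleton.elim _ _)
  simpa using this

theorem cls_coprod (X Y : Var k) : cls (X.coprod Y) = cls X + cls Y :=
  haveI := quasiCompact_coprodDesc X.str Y.str
  cls_mk_eq_add (coprod.desc X.str Y.str) X.str Y.str coprod.inl coprod.inr
    (coprod.inl_desc _ _) (coprod.inr_desc _ _) (isCompl_range_inl_inr _ _).compl_eq.symm

/-- `X_red` is closed in `X` with empty complement. -/
theorem cls_red (X : Var k) : cls X.red = cls X := by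
  have : IsEmpty (Var.empty k).scheme := inferInstanceAs (IsEmpty (∅ : Scheme.{u}))
  have : cls X = cls X.red + cls (Var.empty k) := cls_mk_eq_add X.str
    (X.scheme.nilradical.subschemeι ≫ X.str) (Scheme.emptyTo _) X.scheme.nilradical.subschemeι
    (Scheme.emptyTo X.scheme) rfl (Scheme.empty_ext _ _) (by
      rw [Set.range_eq_empty, Scheme.IdealSheafData.range_subschemeι,
        Scheme.support_nilradical]
      simp)
  rw [this, cls_of_isEmpty (Var.empty k), add_zero]

theorem cls_affineSpace (n : ℕ) (X : Var k) : cls (X.affineSpace n) = cls X * lefschetz k ^ n := by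
  induction n with
  | zero => rw [pow_zero, mul_one, cls_eq_of_iso X.affineSpaceZeroIso]
  | succ n ih =>
    rw [cls_eq_of_iso (X.affineSpaceAddIso n 1), cls_eq_of_iso (Var.affineSpaceOneIso _),
      cls_tensor, ih, pow_succ, mul_assoc]
    rfl

end K0
end MotivicK0

end

/-! ### Clearing denominators in the dimension filtration. -/

noncomputable section

namespace MotivicK0

open Limits MonoidalCategory
variable {k : Type u} [Field k]

/-- The canonical map `K₀(Var_k) → K₀(Var_k)[𝕃⁻¹]`. -/
abbrev K0.toLoc : K0 k →+* K0Loc k := algebraMap _ _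

theorem Var.IsPureDim.topologicalKrullDim_le {X : Var k} {d : ℕ} (h : X.IsPureDim d) :
    topologicalKrullDim X.scheme ≤ d :=
  topologicalKrullDim_le_of_irreducibleComponents fun Z hZ ↦ (h Z hZ).le

theorem Var.topologicalKrullDim_affineSpace_le {X : Var k} {d : ℕ} (n : ℕ)
    (h : topologicalKrullDim X.scheme ≤ d) :
    topologicalKrullDim (X.affineSpace n).scheme ≤ (d + n : ℕ) := by
  have := AffineSpace.topologicalKrullDim_le (ULift.{u} (Fin n)) X.scheme h
  rw [Nat.card_eq_fintype_card, Fintype.card_ulift, Fintype.card_fin] at this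
  exact this

theorem Var.le_topologicalKrullDim_affineSpace {X : Var k} {d : ℕ} (n : ℕ)
    (h : d ≤ topologicalKrullDim X.scheme) :
    (d + n : ℕ) ≤ topologicalKrullDim (X.affineSpace n).scheme := by
  have := AffineSpace.le_topologicalKrullDim (ULift.{u} (Fin n)) X.scheme h
  rw [Nat.card_eq_fintype_card, Fintype.card_ulift, Fintype.card_fin] at this
  exact this

theorem frac_mul_lefschetz_pow (X : Var k) (r n : ℕ) :
    frac X r * K0.toLoc (K0.lefschetz k) ^ (r + n) = K0.toLoc (K0.cls (X.affineSpace n)) := by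
  have h : frac X r * K0.toLoc (K0.lefschetz k ^ r) = K0.toLoc (K0.cls X) := by
    rw [frac, Localization.mk_eq_mk']
    exact IsLocalization.mk'_spec (K0Loc k) _ _
  rw [K0.cls_affineSpace, map_mul, ← h, pow_add, map_pow, map_pow, mul_assoc]

/-- A generator `[S]/𝕃ʳ` has `dim S ≤ r - 1`, so it becomes `[𝔸ᴺ⁺¹⁻ʳ × S]`, of dimension at most
`N`. Sums become disjoint unions and negation swaps `P` and `Q`. Allowing every `N ≥ N₀` lets two
summands share an exponent. -/
theorem exists_eq_sub_of_mem_dimFiltration {x : K0Loc k} (hx : x ∈ dimFiltration k (-1)) :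
    ∃ N₀ : ℕ, ∀ N ≥ N₀, ∃ P Q : Var k, topologicalKrullDim P.scheme ≤ N ∧
      topologicalKrullDim Q.scheme ≤ N ∧
      x * K0.toLoc (K0.lefschetz k) ^ (N + 1) = K0.toLoc (K0.cls P) - K0.toLoc (K0.cls Q) := by
  have hempty (N : ℕ) : topologicalKrullDim (Var.empty k).scheme ≤ N :=
    iSup_le fun l ↦ PEmpty.elim l.head.isIrreducible.nonempty.some
  have hcls : K0.cls (Var.empty k) = 0 :=
    have : IsEmpty (Var.empty k).scheme := inferInstanceAs (IsEmpty (∅ : Scheme.{u}))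
    K0.cls_of_isEmpty _
  induction hx using AddSubgroup.closure_induction with
  | mem x hx =>
    obtain ⟨S, r, d, hS, hd, rfl⟩ := hx
    refine ⟨r, fun N hN ↦ ⟨S.affineSpace (N + 1 - r), Var.empty k, ?_, hempty N, ?_⟩⟩
    · exact (Var.topologicalKrullDim_affineSpace_le _ hS.topologicalKrullDim_le).trans
        (by exact_mod_cast (show d + (N + 1 - r) ≤ N by omega))
    · rw [← frac_mul_lefschetz_pow, hcls, map_zero, sub_zero, show r + (N + 1 - r) = N + 1 by omega]
  | zero => exact ⟨0, fun N _ ↦ ⟨Var.empty k, Var.empty k, hempty N, hempty N, by simp⟩⟩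
  | add x y _ _ hx hy =>
    obtain ⟨M, hM⟩ := hx
    obtain ⟨M', hM'⟩ := hy
    refine ⟨max M M', fun N hN ↦ ?_⟩
    obtain ⟨P, Q, hP, hQ, h⟩ := hM N (le_of_max_le_left hN)
    obtain ⟨P', Q', hP', hQ', h'⟩ := hM' N (le_of_max_le_right hN)
    refine ⟨P.coprod P', Q.coprod Q', topologicalKrullDim_coprod_le hP hP',
      topologicalKrullDim_coprod_le hQ hQ', ?_⟩
    rw [add_mul, h, h', K0.cls_coprod, K0.cls_coprod, map_add, map_add]
    ring
  | neg x _ hx =>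
    obtain ⟨M, hM⟩ := hx
    refine ⟨M, fun N hN ↦ ?_⟩
    obtain ⟨P, Q, hP, hQ, h⟩ := hM N hN
    exact ⟨Q, P, hQ, hP, by rw [neg_mul, h, neg_sub]⟩

theorem exists_cls_coprod_eq {X Y : Var k} {d e : ℕ}
    (h : frac X d - frac Y e ∈ dimFiltration k (-1)) :
    ∃ (a b N : ℕ) (P Q : Var k), d + a = N + 1 ∧ e + b = N + 1 ∧
      topologicalKrullDim P.scheme ≤ N ∧ topologicalKrullDim Q.scheme ≤ N ∧
      K0.cls ((X.affineSpace a).coprod Q) = K0.cls ((Y.affineSpace b).coprod P) := by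
  obtain ⟨N₀, hN₀⟩ := exists_eq_sub_of_mem_dimFiltration h
  let N := max N₀ (max d e)
  obtain ⟨P, Q, hP, hQ, hPQ⟩ := hN₀ N (le_max_left _ _)
  obtain ⟨a, ha⟩ : ∃ a, d + a = N + 1 := ⟨N + 1 - d, by omega⟩
  obtain ⟨b, hb⟩ : ∃ b, e + b = N + 1 := ⟨N + 1 - e, by omega⟩
  rw [sub_mul, ← ha, frac_mul_lefschetz_pow, ha, ← hb, frac_mul_lefschetz_pow,
    sub_eq_sub_iff_add_eq_add, ← map_add, ← map_add] at hPQ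
  -- Equality in the localization means equality in `K₀(Var_k)` after multiplication by some `𝕃ᶜ`;
  -- replacing every variety by its product with `𝔸ᶜ` absorbs this factor and shifts all dimensions
  -- equally.
  obtain ⟨⟨_, c, rfl⟩, hc⟩ := IsLocalization.exists_of_eq (M := .powers (K0.lefschetz k)) hPQ
  refine ⟨a + c, b + c, N + c, P.affineSpace c, Q.affineSpace c, by omega, by omega,
    Var.topologicalKrullDim_affineSpace_le c hP, Var.topologicalKrullDim_affineSpace_le c hQ, ?_⟩
  simp only [K0.cls_coprod, K0.cls_affineSpace, pow_add] at hc ⊢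
  linear_combination hc

end MotivicK0

end

/-! ### Reduced structures, and birationality from cut-and-paste. -/

theorem Topology.IsInducing.topologicalKrullDim_le_of_range_subset {X Y : Type*}
    [TopologicalSpace X] [TopologicalSpace Y] {f : Y → X} (hf : IsInducing f) {S : Set X}
    (h : Set.range f ⊆ S) : topologicalKrullDim Y ≤ topologicalKrullDim S :=
  (hf.codRestrict fun y ↦ h ⟨y, rfl⟩).topologicalKrullDim_le

theorem Topology.IsEmbedding.topologicalKrullDim_image {X Y : Type*} [TopologicalSpace X]
    [TopologicalSpace Y] {f : Y → X} (hf : IsEmbedding f) (S : Set Y) :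
    topologicalKrullDim (f '' S) = topologicalKrullDim S :=
  ((hf.homeomorphImage S).isHomeomorph.topologicalKrullDim_eq _).symm

theorem AlgebraicGeometry.Scheme.isHomeomorph_subschemeι_nilradical (X : Scheme.{u}) :
    IsHomeomorph X.nilradical.subschemeι :=
  isHomeomorph_iff_isEmbedding_surjective.2
    ⟨X.nilradical.subschemeι.isClosedEmbedding.isEmbedding, Set.range_eq_univ.1 <| by
      rw [Scheme.IdealSheafData.range_subschemeι, Scheme.support_nilradical]; rfl⟩

instance AlgebraicGeometry.Scheme.isReduced_nilradical_subscheme (X : Scheme.{u}) :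
    IsReduced X.nilradical.subscheme := by
  let 𝒰 := X.nilradical.subschemeCover.openCover
  have (U : X.affineOpens) : IsReduced (𝒰.X U) := by
    have : _root_.IsReduced (Γ(X, U) ⧸ X.nilradical.ideal U) :=
      (Ideal.isRadical_iff_quotient_reduced _).1 (Ideal.radical_isRadical _)
    exact inferInstanceAs (IsReduced (Spec (.of (Γ(X, U) ⧸ X.nilradical.ideal U))))
  exact (IsReduced.iff_of_openCover _ 𝒰).2 this

instance AlgebraicGeometry.Scheme.isIntegral_nilradical_subscheme (X : Scheme.{u})
    [IrreducibleSpace X] : IsIntegral X.nilradical.subscheme := by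
  let h := X.isHomeomorph_subschemeι_nilradical.homeomorph
  have : IrreducibleSpace X.nilradical.subscheme :=
    (irreducibleSpace_def _).2 (by
      have := (irreducibleSpace_def X).1 inferInstance
      simpa using this.image h.symm h.symm.continuous.continuousOn)
  exact isIntegral_of_irreducibleSpace_of_isReduced _

noncomputable section

namespace MotivicK0

open Limits

/-- An irreducible space of dimension larger than `dim Q` and at least `dim E` which is immersed
into `E ⊔ Q` has the generic point of `E` as its generic point. -/
theorem eq_inl_genericPoint_of_isInducing {V : Type*} [TopologicalSpace V] {E Q : Scheme.{u}}
    [IrreducibleSpace E] {n : ℕ} (hE : topologicalKrullDim E ≤ (n + 1 : ℕ))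
    (hQ : topologicalKrullDim Q ≤ n) (hV : (n + 1 : ℕ) ≤ topologicalKrullDim V)
    {q : V → (E ⨿ Q : Scheme.{u})} (hq : Topology.IsInducing q) {v : V} (hv : ∀ w, v ⤳ w) :
    q v = (coprod.inl : E ⟶ E ⨿ Q) (genericPoint E) := by
  have hspec (w : V) : q v ⤳ q w := (hv w).map hq.continuous
  have hcompl := isCompl_range_inl_inr E Q
  rcases hcompl.sup_eq_top.ge (Set.mem_univ (q v)) with ⟨y, hy⟩ | ⟨y, hy⟩
  · have hinl := (coprod.inl : E ⟶ E ⨿ Q).isClosedEmbedding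
    have hsub : Set.range q ⊆ (coprod.inl : E ⟶ E ⨿ Q) '' closure {y} := by
      rw [← hinl.closure_image_eq, Set.image_singleton, hy]
      rintro _ ⟨w, rfl⟩
      exact (hspec w).mem_closure
    have hdim := hV.trans (hq.topologicalKrullDim_le_of_range_subset hsub)
    rw [hinl.isEmbedding.topologicalKrullDim_image] at hdim
    rw [← hy]
    congr 1
    -- If `y` were not generic, `V` would sit in a proper closed subset of `E`, of dimension at most
    -- `n`.
    refine ((genericPoint_spec E).eq ?_).symm
    by_contra hne
    exact (hdim.trans_lt (topologicalKrullDim_le_of_ssubset hE isClosed_closure hne)).false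
  · have hcl : IsClosed (Set.range (coprod.inr : Q ⟶ E ⨿ Q)) := by
      rw [← hcompl.compl_eq]
      exact (coprod.inl : E ⟶ E ⨿ Q).isOpenEmbedding.isOpen_range.isClosed_compl
    have hsub : Set.range q ⊆ (coprod.inr : Q ⟶ E ⨿ Q) '' Set.univ := by
      rw [Set.image_univ]
      rintro _ ⟨w, rfl⟩
      exact (hspec w).mem_closed hcl ⟨y, hy⟩
    have hdim := hV.trans (hq.topologicalKrullDim_le_of_range_subset hsub)
    rw [(coprod.inr : Q ⟶ E ⨿ Q).isOpenEmbedding.isEmbedding.topologicalKrullDim_image] at hdim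
    have := hdim.trans ((topologicalKrullDim_subspace_le Q _).trans hQ)
    have : n + 1 ≤ n := by exact_mod_cast this
    omega

variable {k : Type u} [Field k]

/-- The generic point of `E₁` is followed through its piece `Z i ≅ W i` into `E₂ ⊔ Q`. Transport
goes in this direction only, so only `Q` has to be small. -/
theorem birationalOver_of_cls_coprod_eq (hcp : CutAndPaste k) {E₁ E₂ P Q : Var k}
    [IsIntegral E₁.scheme] [IsIntegral E₂.scheme] {n : ℕ}
    (h₁ : (n + 1 : ℕ) ≤ topologicalKrullDim E₁.scheme)
    (h₂ : topologicalKrullDim E₂.scheme ≤ (n + 1 : ℕ))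
    (hQ : topologicalKrullDim Q.scheme ≤ n)
    (h : K0.cls (E₁.coprod P) = K0.cls (E₂.coprod Q)) :
    Scheme.BirationalOver E₁.str E₂.str := by
  obtain ⟨m, Z, W, ⟨f, hf, -, hfu⟩, ⟨g, hg, -, -⟩, e⟩ := hcp _ _ h
  let inl₁ : E₁.scheme ⟶ E₁.scheme ⨿ P.scheme := coprod.inl
  let inl₂ : E₂.scheme ⟶ E₂.scheme ⨿ Q.scheme := coprod.inl
  obtain ⟨i, z, hz⟩ : ∃ i, inl₁ (genericPoint E₁.scheme) ∈ Set.range (f i).left :=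
    Set.mem_iUnion.1 (hfu.ge trivial)
  let φ : (Z i).scheme ≅ (W i).scheme :=
    (Over.forget _).mapIso ((isVariety k).ι.mapIso (e i).some)
  have hφ : φ.hom ≫ (W i).str = (Z i).str := Over.w ((isVariety k).ι.mapIso (e i).some).hom
  let f' : (Z i).scheme ⟶ E₁.scheme ⨿ P.scheme := (f i).left
  let g' : (W i).scheme ⟶ E₂.scheme ⨿ Q.scheme := (g i).left
  have : IsImmersion f' := hf i
  have : IsImmersion g' := hg i
  have hf's : f' ≫ coprod.desc E₁.str P.str = (Z i).str := Over.w (f i)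
  have hg's : g' ≫ coprod.desc E₂.str Q.str = (W i).str := Over.w (g i)
  obtain ⟨V, a, hzV, _, ha⟩ := exists_isOpenImmersion_of_genericPoint f' inl₁ (z := z) hz
  have hza : a ⟨z, hzV⟩ = genericPoint E₁.scheme := by
    apply inl₁.isOpenEmbedding.injective
    refine Eq.trans ?_ hz
    exact congr_arg (fun p : V.toScheme ⟶ _ ↦ p ⟨z, hzV⟩) ha
  have hgen (v : V.toScheme) : (⟨z, hzV⟩ : V.toScheme) ⤳ v := by
    refine a.isOpenEmbedding.isInducing.specializes_iff.1 ?_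
    exact (specializes_of_eq hza).trans (genericPoint_specializes _)
  -- `V` is isomorphic to a nonempty open subset of `E₁`, hence has its full dimension.
  have hV : (n + 1 : ℕ) ≤ topologicalKrullDim V.toScheme := by
    refine h₁.trans ((topologicalKrullDim_le_of_isOpen E₁.str a.isOpenEmbedding.isOpen_range
      ⟨_, _, hza⟩).trans ?_)
    rw [← Set.image_univ, a.isOpenEmbedding.isEmbedding.topologicalKrullDim_image]
    exact topologicalKrullDim_subspace_le _ _
  have hw : g' (φ.hom z) = inl₂ (genericPoint E₂.scheme) :=
    eq_inl_genericPoint_of_isInducing h₂ hQ hV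
      (V.ι ≫ φ.hom ≫ g').isEmbedding.isInducing (v := ⟨z, hzV⟩) hgen
  obtain ⟨V', b, hwV', _, hb⟩ := exists_isOpenImmersion_of_genericPoint g' inl₂ hw
  -- The common open set: inside `E₁` through `a`, and inside `E₂` through `φ` and `b`.
  let U : (Z i).scheme.Opens := V ⊓ φ.hom ⁻¹ᵁ V'
  let u₁ : U.toScheme ⟶ E₁.scheme := (Z i).scheme.homOfLE inf_le_left ≫ a
  let u₂ : U.toScheme ⟶ E₂.scheme := (Z i).scheme.homOfLE inf_le_right ≫ (φ.hom ∣_ V') ≫ b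
  have hne : Nonempty U := ⟨⟨z, hzV, hwV'⟩⟩
  have hu₁ : u₁ ≫ E₁.str = U.ι ≫ (Z i).str := by
    have hs : inl₁ ≫ coprod.desc E₁.str P.str = E₁.str := coprod.inl_desc _ _
    refine (congr_arg (u₁ ≫ ·) hs.symm).trans ?_
    simp only [u₁, Category.assoc, reassoc_of% ha, Scheme.homOfLE_ι_assoc, hf's]
  have hu₂ : u₂ ≫ E₂.str = U.ι ≫ (Z i).str := by
    have hs : inl₂ ≫ coprod.desc E₂.str Q.str = E₂.str := coprod.inl_desc _ _
    refine (congr_arg (u₂ ≫ ·) hs.symm).trans ?_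
    simp only [u₂, Category.assoc, reassoc_of% hb, Scheme.homOfLE_ι_assoc,
      morphismRestrict_ι_assoc, hg's, hφ]
  have : IsDominant u₁ := ⟨u₁.isOpenEmbedding.isOpen_range.dense (Set.range_nonempty _)⟩
  have : IsDominant u₂ := ⟨u₂.isOpenEmbedding.isOpen_range.dense (Set.range_nonempty _)⟩
  exact (u₁.birationalOver E₁.str _ hu₁).symm.trans (u₂.birationalOver E₂.str _ hu₂)

theorem stablyBirational_of_isIntegral (hcp : CutAndPaste k) {X Y : Var k} [IsIntegral X.scheme]
    [IsIntegral Y.scheme] {d e : ℕ} (hd : topologicalKrullDim X.scheme = d)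
    (he : topologicalKrullDim Y.scheme = e) (h : frac X d - frac Y e ∈ dimFiltration k (-1)) :
    StablyBirational X Y := by
  obtain ⟨a, b, N, P, Q, ha, hb, hP, hQ, hPQ⟩ := exists_cls_coprod_eq h
  have : IsIntegral (X.affineSpace a).scheme :=
    inferInstanceAs (IsIntegral 𝔸(ULift.{u} (Fin a); X.scheme))
  have : IsIntegral (Y.affineSpace b).scheme :=
    inferInstanceAs (IsIntegral 𝔸(ULift.{u} (Fin b); Y.scheme))
  -- `P` is the summand joined to `𝔸ᵇ × Y`, so its bound `hP` is the one required.
  exact ⟨a, b, birationalOver_of_cls_coprod_eq hcp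
    (ha ▸ Var.le_topologicalKrullDim_affineSpace a hd.ge)
    (hb ▸ Var.topologicalKrullDim_affineSpace_le b he.le) hP hPQ⟩

theorem frac_red (X : Var k) (r : ℕ) : frac X.red r = frac X r := by
  rw [frac, K0.cls_red, frac]

theorem Var.topologicalKrullDim_red (X : Var k) :
    topologicalKrullDim X.red.scheme = topologicalKrullDim X.scheme :=
  X.scheme.isHomeomorph_subschemeι_nilradical.topologicalKrullDim_eq

instance (X : Var k) [IrreducibleSpace X.scheme] : IsIntegral X.red.scheme :=
  inferInstanceAs (IsIntegral X.scheme.nilradical.subscheme)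

end MotivicK0

end

theorem proposition3p6 {k : Type u} [Field k] [IsAlgClosed k] [CharZero k]
    (hcp : MotivicK0.CutAndPaste k)
    (X Y : MotivicK0.Var k) [IrreducibleSpace X.scheme] [IrreducibleSpace Y.scheme]
    {d e : ℕ} (hd : topologicalKrullDim X.scheme = d) (he : topologicalKrullDim Y.scheme = e)
    (h : MotivicK0.normalizedClass X hd = MotivicK0.normalizedClass Y he) :
    MotivicK0.StablyBirational X.red Y.red ∧
      (IsReduced X.scheme → IsReduced Y.scheme → MotivicK0.StablyBirational X Y) := by
  have h' : MotivicK0.frac X d - MotivicK0.frac Y e ∈ MotivicK0.dimFiltration k (-1) := by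
    have := QuotientAddGroup.eq.1 h.symm
    rwa [AddSubgroup.mem_addSubgroupOf, neg_add_eq_sub] at this
  refine ⟨?_, fun _ _ ↦ ?_⟩
  · exact MotivicK0.stablyBirational_of_isIntegral hcp (X.topologicalKrullDim_red.trans hd)
      (Y.topologicalKrullDim_red.trans he) (by rwa [MotivicK0.frac_red, MotivicK0.frac_red])
  · have := isIntegral_of_irreducibleSpace_of_isReduced X.scheme
    have := isIntegral_of_irreducibleSpace_of_isReduced Y.scheme
    exact MotivicK0.stablyBirational_of_isIntegral hcp hd he h'
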